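/- Let $\lambda_0,\lambda_1>0$, $\gamma_0>0$, $a_0\in\mathbb R$, and put $a_1=1$, $\gamma_1=0$, $\rho_0=a_0/\gamma_0$. Let $\varepsilon=(\varepsilon(t))_{t\ge0}$ be a continuous-time Markov chain on $\{0,1\}$ (with right-continuous paths, the holding times being independent and exponential with rate $\lambda_j$ in state $j$) which switches from $0$ to $1$ with intensity $\lambda_0$ and from $1$ to $0$ with intensity $\lambda_1$, and let $X=(X(t))_{t\ge 0}$ be the Kac--Ornstein--Uhlenbeck process \[ X(t)=x+\int_0^t\bigl(a_{\varepsilon(s)}-\gamma_{\varepsilon(s)}X(s)\bigr)\,ds,\qquad t\ge0 . \] Let $T(x,y)=\inf\{t>0: X(t)=y\}$ (with $\inf\emptyset=\infty$), and for $q\ge0$ and $i\in\{0,1\}$ let $\ell_i(q,x,y)=\mathbb E_i[e^{-qT(x,y)}]$, where $\mathbb E_i$ is the expectation given $\varepsilon(0)=i$ and $e^{-q\cdot\infty}=0$. Suppose that $x<y$ and $\rho_0\le y$. Then $T(x,y)$ is a (extended real-valued) random variable up to a null set, and \[ \ell_0(q,x,y)=\frac{\lambda_0/\gamma_0}{\beta_0}\cdot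 \frac{\Phi\bigl(\delta;1+\beta_0;(x-\rho_0)(q+\lambda_1)\bigr)}{\Phi\bigl(\delta;\beta_0;(y-\rho_0)(q+\lambda_1)\bigr)},\qquad \ell_1(q,x,y)= \frac{\Phi\bigl(\delta;\beta_0;(x-\rho_0)(q+\lambda_1)\bigr)}{\Phi\bigl(\delta;\beta_0;(y-\rho_0)(q+\lambda_1)\bigr)}, \] where \[ \beta_0=\frac{q+\lambda_0}{\gamma_0},\qquad \delta=\frac{(q+\lambda_0)(q+\lambda_1)-\lambda_0\lambda_1}{\gamma_0(q+\lambda_1)}, \] the denominators are nonzero, and $\Phi(a;c;z)=\sum_{n\ge0}\frac{(a)_n}{(c)_n\,n!}z^n$, $(b)_n=b(b+1)\cdots(b+n-1)$, is the confluent hypergeometric function. -/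

import Mathlib

open MeasureTheory ProbabilityTheory
open scoped ENNReal

noncomputable section

/-- The confluent hypergeometric (Kummer) function
`Φ(a; c; z) = ∑ₙ (a)ₙ / ((c)ₙ n!) zⁿ`, where `(b)ₙ = b (b + 1) ⋯ (b + n - 1)`. -/
def confluentHypergeometric (a c z : ℝ) : ℝ :=
  ∑' n : ℕ, (ascPochhammer ℝ n).eval a / ((ascPochhammer ℝ n).eval c * (n.factorial : ℝ)) * z ^ n

/-- The state after `n` switches of a two-state process that starts in state `i`. -/
def stateAfter (i : Fin 2) (n : ℕ) : Fin 2 := if Even n then i else 1 - i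

/-- `ε` is, under `P`, a continuous-time Markov chain on the state space `{0, 1}` with
transition intensities `lam 0` (from `0` to `1`) and `lam 1` (from `1` to `0`), started from
state `i`: its successive holding times `τ 0, τ 1, …` are independent, the holding time in a
state `j` is exponentially distributed with rate `lam j`, and between two successive switching
times `τ 0 + ⋯ + τ (n - 1)` and `τ 0 + ⋯ + τ n` the state is constant (with right-continuous
paths). Only times `t ≥ 0` matter. -/
def IsTwoStateMarkovChain {Ω : Type*} [MeasurableSpace Ω] (P : Measure Ω)
    (lam : Fin 2 → ℝ) (i : Fin 2) (ε : ℝ → Ω → Fin 2) : Prop :=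
  ∃ τ : ℕ → Ω → ℝ,
    iIndepFun τ P ∧
    (∀ n, HasLaw (τ n) (expMeasure (lam (stateAfter i n))) P) ∧
    ∀ᵐ ω ∂P, ∀ (n : ℕ) (t : ℝ),
      ∑ k ∈ Finset.range n, τ k ω ≤ t → t < ∑ k ∈ Finset.range (n + 1), τ k ω →
        ε t ω = stateAfter i n

/-- `X` is the Kac-Ornstein-Uhlenbeck process with parameters `a`, `γ`, started from `x` and
driven by `ε`: almost surely, for all `t ≥ 0`,
`X t = x + ∫₀ᵗ (a_{ε s} - γ_{ε s} X s) ds`. -/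
def IsKacOrnsteinUhlenbeck {Ω : Type*} [MeasurableSpace Ω] (P : Measure Ω)
    (a γ : Fin 2 → ℝ) (ε : ℝ → Ω → Fin 2) (x : ℝ) (X : ℝ → Ω → ℝ) : Prop :=
  ∀ᵐ ω ∂P, ∀ t : ℝ, 0 ≤ t →
    IntervalIntegrable (fun s => a (ε s ω) - γ (ε s ω) * X s ω) volume 0 t ∧
    X t ω = x + ∫ s in (0 : ℝ)..t, (a (ε s ω) - γ (ε s ω) * X s ω)

/-- The first passage time `inf {t > 0 : X t = y}`, equal to `∞` if the level `y` is never
reached. -/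
def firstPassageTime {Ω : Type*} (X : ℝ → Ω → ℝ) (y : ℝ) (ω : Ω) : ℝ≥0∞ :=
  ⨅ (t : ℝ) (_ : 0 < t ∧ X t ω = y), ENNReal.ofReal t

/-- The Laplace transform `E[exp (-q T)]` of a random time `T` with values in `[0, ∞]`,
with `exp (-q ∞) = 0`. -/
def laplaceOfTime {Ω : Type*} [MeasurableSpace Ω] (P : Measure Ω) (T : Ω → ℝ≥0∞) (q : ℝ) : ℝ :=
  ∫ ω, {ω | T ω ≠ ∞}.indicator (fun ω => Real.exp (-(q * (T ω).toReal))) ω ∂P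

end

/-! ### Kummer series and their contiguous relations -/

section Kummer

open Polynomial

/-! Between switches the motion is deterministic: attraction to `ρ` in state `0`, unit upward drift
in state `1`. Conditioning on the first holding time gives one-step equations linking the two
Laplace transforms. The proof verifies a solution: a continuous pair `F 0`, `F 1` satisfying these
equations must be the pair of transforms (`tendsto_integral_reward`).

The reason is a conserved quantity. Let `discount` be the discount factor at the `n`-th switch,
killed after a crossing, and `reward` the discounted payment of `1` at the crossing. By the one-step
equations, the expectation of discount times `F` at the current level, plus the expected reward, is
the same for all `n`, hence equal to `F i x`. Levels not yet killed stay in `[min x ρ, y]`, where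
`F` is bounded, and each holding time in state `1` crosses `y` with probability bounded below, so
the first term tends to `0`. Pathwise the reward is eventually `exp (-(q * T))`, and dominated
convergence identifies the limit. Only finitely many holding intervals matter on almost every path,
so non-explosion of the chain is not needed.

The one-step equations are integrated forms of `F₁' = (q + λ₁) F₁ - λ₁ F₀` with `F₁(y) = 1`, and `γ
(ρ - w) F₀' = (q + λ₀) F₀ - λ₀ F₁`. Since `ρ ≤ y`, state `0` cannot cross `y`, so `F₀` needs no
boundary value at `y`; regularity at `ρ` is what matters. After the substitution `z = (w - ρ)(q +
λ₁)` the system becomes two contiguous relations for Kummer's function. -/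

theorem summable_egf {a : ℕ → ℝ} (ha : ∀ n, |a n| ≤ 1) (z : ℝ) :
    Summable fun n : ℕ => a n / (n.factorial : ℝ) * z ^ n := by
  refine Summable.of_norm_bounded (Real.summable_pow_div_factorial |z|) fun n => ?_
  rw [Real.norm_eq_abs, abs_mul, abs_div, abs_pow, Nat.abs_cast, div_mul_eq_mul_div]
  gcongr
  exact mul_le_of_le_one_left (by positivity) (ha n)

/-- Termwise differentiation of an exponential generating function with bounded coefficients. -/
theorem hasDerivAt_egf {a : ℕ → ℝ} (ha : ∀ n, |a n| ≤ 1) (z : ℝ) :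
    HasDerivAt (fun z : ℝ => ∑' n : ℕ, a n / (n.factorial : ℝ) * z ^ n)
      (∑' n : ℕ, a (n + 1) / (n.factorial : ℝ) * z ^ n) z := by
  have key : ∀ (n : ℕ) (w : ℝ),
      a (n + 1) / ((n + 1).factorial : ℝ) * (((n + 1 : ℕ) : ℝ) * w ^ n) =
        a (n + 1) / (n.factorial : ℝ) * w ^ n := by
    intro n w
    have : (n.factorial : ℝ) ≠ 0 := by positivity
    rw [Nat.factorial_succ]
    push_cast
    field_simp
  -- Dominates the derivative series on the ball of radius `|z| + 1`, a bounded neighbourhood of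
  -- `z`.
  have hu : Summable fun n : ℕ => (n : ℝ) * (|z| + 1) ^ (n - 1) / (n.factorial : ℝ) := by
    rw [← summable_nat_add_iff 1]
    refine (Real.summable_pow_div_factorial (|z| + 1)).congr fun n => ?_
    have : (n.factorial : ℝ) ≠ 0 := by positivity
    rw [Nat.factorial_succ, Nat.add_sub_cancel]
    push_cast
    field_simp
  have hz : z ∈ Metric.ball (0 : ℝ) (|z| + 1) := by simp
  have h := hasDerivAt_tsum_of_isPreconnected (g := fun (n : ℕ) (w : ℝ) =>
      a n / (n.factorial : ℝ) * w ^ n)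
    (g' := fun (n : ℕ) (w : ℝ) => a n / (n.factorial : ℝ) * ((n : ℝ) * w ^ (n - 1)))
    hu Metric.isOpen_ball (convex_ball (0 : ℝ) (|z| + 1)).isPreconnected
    (fun n w _ => (hasDerivAt_pow n w).const_mul _) ?_ hz (summable_egf ha z) hz
  · refine h.congr_deriv ?_
    rw [Summable.tsum_eq_zero_add]
    · simp only [Nat.cast_zero, zero_mul, mul_zero, zero_add, Nat.add_sub_cancel]
      exact tsum_congr fun n => key n z
    · rw [← summable_nat_add_iff 1]
      refine (summable_egf (a := fun n => a (n + 1)) (fun n => ha _) z).congr fun n => ?_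
      exact (key n z).symm
  · intro n w hw
    have hw' : |w| ≤ |z| + 1 := by
      simpa using (Metric.mem_ball.1 hw).le
    rw [Real.norm_eq_abs, abs_mul, abs_div, abs_mul, abs_pow, Nat.abs_cast, Nat.abs_cast,
      div_mul_eq_mul_div]
    refine div_le_div_of_nonneg_right ?_ (by positivity)
    calc |a n| * (n * |w| ^ (n - 1)) ≤ 1 * (n * |w| ^ (n - 1)) := by
          gcongr; exact ha n
      _ ≤ n * (|z| + 1) ^ (n - 1) := by rw [one_mul]; gcongr

/-- The ratio `(a)ₙ / (c)ₙ` of rising factorials. -/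
noncomputable def pochhammerRatio (a c : ℝ) (n : ℕ) : ℝ :=
  (ascPochhammer ℝ n).eval a / (ascPochhammer ℝ n).eval c

theorem pochhammerRatio_succ (a c : ℝ) (n : ℕ) :
    pochhammerRatio a c (n + 1) = pochhammerRatio a c n * ((a + n) / (c + n)) := by
  simp only [pochhammerRatio, ascPochhammer_succ_eval]
  rw [mul_div_mul_comm]

/-- Each factor `(a + k) / (c + k)` lies in `[0, 1]`. Hence the Kummer series needed here are
dominated by the exponential series. -/
theorem pochhammerRatio_mem_Icc {a c : ℝ} (ha : 0 ≤ a) (hac : a ≤ c) (hc : 0 < c) (n : ℕ) :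
    pochhammerRatio a c n ∈ Set.Icc (0 : ℝ) 1 := by
  induction n with
  | zero => simp [pochhammerRatio]
  | succ n ih =>
    rw [pochhammerRatio_succ]
    have h1 : 0 ≤ (a + n) / (c + n) := by positivity
    have h2 : (a + n) / (c + n) ≤ 1 := by
      rw [div_le_one (by positivity)]; linarith
    exact ⟨mul_nonneg ih.1 h1, mul_le_one₀ ih.2 h1 h2⟩

theorem abs_pochhammerRatio_le {a c : ℝ} (ha : 0 ≤ a) (hac : a ≤ c) (hc : 0 < c) (n : ℕ) :
    |pochhammerRatio a c n| ≤ 1 := by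
  have h := pochhammerRatio_mem_Icc ha hac hc n
  rw [abs_of_nonneg h.1]
  exact h.2

/-- From `c (c + 1)ₙ = (c)ₙ (c + n)`; both contiguous relations are this identity read
coefficientwise. -/
theorem pochhammerRatio_add_one {a c : ℝ} (hc : 0 < c) (n : ℕ) :
    pochhammerRatio a (c + 1) n * (c + n) = c * pochhammerRatio a c n := by
  induction n with
  | zero => simp [pochhammerRatio]
  | succ n ih =>
    rw [pochhammerRatio_succ, pochhammerRatio_succ]
    have h1 : c + n ≠ 0 := by positivity
    have h2 : c + 1 + n ≠ 0 := by positivity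
    push_cast
    field_simp
    linear_combination (a + n) * (c + n + 1) * ih

theorem confluentHypergeometric_eq (a c z : ℝ) :
    confluentHypergeometric a c z =
      ∑' n : ℕ, pochhammerRatio a c n / (n.factorial : ℝ) * z ^ n := by
  simp only [confluentHypergeometric, pochhammerRatio, div_div]

/-- All terms are nonnegative and the zeroth is `1`. This makes the denominators nonzero, because `ρ
≤ y`. -/
theorem one_le_confluentHypergeometric {a c z : ℝ} (ha : 0 ≤ a) (hac : a ≤ c) (hc : 0 < c)
    (hz : 0 ≤ z) : 1 ≤ confluentHypergeometric a c z := by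
  rw [confluentHypergeometric_eq]
  have h := (summable_egf (abs_pochhammerRatio_le ha hac hc) z).le_tsum 0 fun n _ =>
    mul_nonneg (div_nonneg (pochhammerRatio_mem_Icc ha hac hc n).1 (by positivity))
      (pow_nonneg hz n)
  simpa [pochhammerRatio] using h

/-- `Φ'(a; c; z) = Φ(a; c; z) - (c - a) / c * Φ(a; c + 1; z)`. -/
theorem hasDerivAt_confluentHypergeometric {a c : ℝ} (ha : 0 ≤ a) (hac : a ≤ c) (hc : 0 < c)
    (z : ℝ) :
    HasDerivAt (confluentHypergeometric a c)
      (confluentHypergeometric a c z - (c - a) / c * confluentHypergeometric a (c + 1) z) z := by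
  have h := hasDerivAt_egf (abs_pochhammerRatio_le ha hac hc) z
  have hs := summable_egf (abs_pochhammerRatio_le ha hac hc) z
  have hs' := summable_egf (abs_pochhammerRatio_le ha (by linarith : a ≤ c + 1)
    (by positivity)) z
  rw [funext (confluentHypergeometric_eq a c), confluentHypergeometric_eq]
  refine h.congr_deriv ?_
  rw [← tsum_mul_left, ← hs.tsum_sub (hs'.mul_left _)]
  refine tsum_congr fun n => ?_
  have h1 : c + n ≠ 0 := by positivity
  -- Coefficientwise the claim is `(a + n) / (c + n) = 1 - (c - a) / (c + n)`.
  have h2 := pochhammerRatio_add_one (a := a) hc n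
  rw [← eq_div_iff h1] at h2
  rw [pochhammerRatio_succ, h2]
  field_simp
  ring

/-- `z Φ'(a; c + 1; z) = c (Φ(a; c; z) - Φ(a; c + 1; z))`. -/
theorem exists_hasDerivAt_confluentHypergeometric_add_one {a c : ℝ} (ha : 0 ≤ a) (hac : a ≤ c)
    (hc : 0 < c) (z : ℝ) :
    ∃ d : ℝ, HasDerivAt (confluentHypergeometric a (c + 1)) d z ∧
      z * d = c * (confluentHypergeometric a c z - confluentHypergeometric a (c + 1) z) := by
  have hb := abs_pochhammerRatio_le ha (by linarith : a ≤ c + 1) (by positivity)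
  refine ⟨∑' n : ℕ, pochhammerRatio a (c + 1) (n + 1) / (n.factorial : ℝ) * z ^ n, ?_, ?_⟩
  · rw [funext (confluentHypergeometric_eq a (c + 1))]
    exact hasDerivAt_egf hb z
  · have hs := summable_egf (abs_pochhammerRatio_le ha hac hc) z
    have hs' := summable_egf hb z
    rw [confluentHypergeometric_eq, confluentHypergeometric_eq, ← hs.tsum_sub hs',
      ← tsum_mul_left, ← tsum_mul_left, ((hs.sub hs').mul_left c).tsum_eq_zero_add]
    -- The constant terms cancel, so the difference of the two series is divisible by `z`. Keeping
    -- the factor `z` on the derivative side includes the singular point `z = 0`.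
    have h0 : c * (pochhammerRatio a c 0 / ((Nat.factorial 0 : ℕ) : ℝ) * z ^ 0 -
        pochhammerRatio a (c + 1) 0 / ((Nat.factorial 0 : ℕ) : ℝ) * z ^ 0) = 0 := by
      simp [pochhammerRatio]
    rw [h0, zero_add]
    refine tsum_congr fun n => ?_
    have h2 := pochhammerRatio_add_one (a := a) hc (n + 1)
    rw [mul_sub, ← mul_assoc c, ← mul_div_assoc, ← h2, Nat.factorial_succ]
    have : (n.factorial : ℝ) ≠ 0 := by positivity
    push_cast
    field_simp
    ring

end Kummer

/-! ### The one-step equations as integrated differential equations -/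

section OneStep

open Set Filter Topology

theorem integral_expMeasure {r : ℝ} (hr : 0 < r) (f : ℝ → ℝ) :
    ∫ t, f t ∂expMeasure r = ∫ t in Ioi 0, r * Real.exp (-(r * t)) * f t := by
  have h : expMeasure r = volume.withDensity (exponentialPDF r) := rfl
  have hm : Measurable (exponentialPDF r) := (measurable_exponentialPDFReal r).ennreal_ofReal
  rw [h, integral_withDensity_eq_integral_toReal_smul hm
    (Eventually.of_forall fun _ => ENNReal.ofReal_lt_top), ← integral_Ici_eq_integral_Ioi,
    ← integral_indicator measurableSet_Ici]
  refine integral_congr_ae (Eventually.of_forall fun t => ?_)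
  simp only [exponentialPDF_eq, smul_eq_mul]
  by_cases ht : 0 ≤ t
  · rw [if_pos ht, indicator_of_mem (mem_Ici.2 ht), ENNReal.toReal_ofReal (by positivity)]
  · rw [if_neg ht, indicator_of_notMem (by simpa using ht)]
    simp

/-- The flow of the Kac-Ornstein-Uhlenbeck dynamics between two switches: exponential attraction
to `ρ` at rate `γ` in state `0`, unit drift in state `1`. -/
noncomputable def kacFlow (ρ γ : ℝ) (j : Fin 2) (z t : ℝ) : ℝ :=
  if j = 0 then ρ + (z - ρ) * Real.exp (-(γ * t)) else z + t

@[simp] theorem kacFlow_zero (ρ γ z t : ℝ) :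
    kacFlow ρ γ 0 z t = ρ + (z - ρ) * Real.exp (-(γ * t)) := rfl

@[simp] theorem kacFlow_one (ρ γ z t : ℝ) : kacFlow ρ γ 1 z t = z + t := rfl

theorem measurable_kacFlow (ρ γ : ℝ) (j : Fin 2) :
    Measurable fun p : ℝ × ℝ => kacFlow ρ γ j p.1 p.2 := by
  unfold kacFlow
  split_ifs <;> fun_prop

theorem kacFlow_zero_lt {ρ γ y z t : ℝ} (hγ : 0 < γ) (hρ : ρ ≤ y) (hz : z < y) (ht : 0 ≤ t) :
    kacFlow ρ γ 0 z t < y := by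
  have h1 : Real.exp (-(γ * t)) ≤ 1 := Real.exp_le_one_iff.2 (by nlinarith)
  have h2 := Real.exp_pos (-(γ * t))
  rw [kacFlow_zero]
  nlinarith

theorem le_kacFlow {ρ γ m z t : ℝ} (hγ : 0 < γ) (hρ : m ≤ ρ) (hz : m ≤ z) (ht : 0 ≤ t)
    (j : Fin 2) : m ≤ kacFlow ρ γ j z t := by
  have h1 : Real.exp (-(γ * t)) ≤ 1 := Real.exp_le_one_iff.2 (by nlinarith)
  have h2 := Real.exp_pos (-(γ * t))
  unfold kacFlow
  split_ifs
  · nlinarith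
  · linarith

/-- The discounted reward collected over a holding time of length `t` in state `j`, started at
level `z`: `F` at the new level if `y` has not been crossed, and `1` when crossing `y`. -/
noncomputable def passageStep (ρ γ y q : ℝ) (j : Fin 2) (F : ℝ → ℝ) (z t : ℝ) : ℝ :=
  if kacFlow ρ γ j z t < y then Real.exp (-(q * t)) * F (kacFlow ρ γ j z t)
  else Real.exp (-(q * (y - z)))

/-- The differential equation makes the integrand on `t < y - z` the derivative of `-exp (-(q + lam)
t) G (z + t)`. The tail `t ≥ y - z`, where the level is crossed, contributes `exp (-(q + lam) (y -
z))`, which cancels the boundary term exactly because `G y = 1`. -/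
theorem integral_passageStep_one {lam q y z : ℝ} (ρ γ : ℝ) (hlam : 0 < lam) (hz : z < y)
    {F G : ℝ → ℝ} (hF : Continuous F)
    (hG : ∀ w, HasDerivAt G ((q + lam) * G w - lam * F w) w) (hGy : G y = 1) :
    ∫ t, passageStep ρ γ y q 1 F z t ∂expMeasure lam = G z := by
  have hh : 0 ≤ y - z := by linarith
  set g : ℝ → ℝ := fun t => lam * Real.exp (-((q + lam) * t)) * F (z + t) with hg
  have hgc : Continuous g := by fun_prop
  have e1 : ∀ t ∈ Ioo 0 (y - z),
      lam * Real.exp (-(lam * t)) * passageStep ρ γ y q 1 F z t = g t := by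
    intro t ht
    have : kacFlow ρ γ 1 z t < y := by rw [kacFlow_one]; linarith [ht.2]
    rw [passageStep, if_pos this]
    simp only [hg, kacFlow_one]
    rw [show -((q + lam) * t) = -(lam * t) + -(q * t) by ring, Real.exp_add]
    ring
  have e2 : ∀ t ∈ Ici (y - z), lam * Real.exp (-(lam * t)) * passageStep ρ γ y q 1 F z t =
      lam * Real.exp (-(q * (y - z))) * Real.exp (-lam * t) := by
    intro t ht
    have : ¬ kacFlow ρ γ 1 z t < y := by rw [kacFlow_one]; linarith [mem_Ici.1 ht]
    rw [passageStep, if_neg this]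
    rw [neg_mul]
    ring
  have i1 : IntegrableOn g (Ioo 0 (y - z)) :=
    hgc.continuousOn.integrableOn_Icc.mono_set Ioo_subset_Icc_self
  have i2 : IntegrableOn (fun t => lam * Real.exp (-(q * (y - z))) * Real.exp (-lam * t))
      (Ici (y - z)) :=
    ((integrableOn_Ici_iff_integrableOn_Ioi (by simp)).2 (exp_neg_integrableOn_Ioi _ hlam)).const_mul _
  have hU : Ioi (0 : ℝ) = Ioo 0 (y - z) ∪ Ici (y - z) :=
    (Ioo_union_Ici_eq_Ioi (by linarith)).symm
  rw [integral_expMeasure hlam, hU, setIntegral_union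
    (by
      rw [Set.disjoint_left]
      intro t h1 h2
      exact absurd h1.2 (not_lt.2 h2))
    measurableSet_Ici
    (i1.congr_fun (fun t ht => (e1 t ht).symm) measurableSet_Ioo)
    (i2.congr_fun (fun t ht => (e2 t ht).symm) measurableSet_Ici),
    setIntegral_congr_fun measurableSet_Ioo e1, setIntegral_congr_fun measurableSet_Ici e2,
    integral_Ici_eq_integral_Ioi, integral_const_mul, integral_exp_mul_Ioi (by linarith),
    ← integral_Ioc_eq_integral_Ioo, ← intervalIntegral.integral_of_le hh]
  have hd : ∀ t ∈ uIcc 0 (y - z),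
      HasDerivAt (fun t => -(Real.exp (-((q + lam) * t)) * G (z + t))) (g t) t := by
    intro t _
    have h1 : HasDerivAt (fun t => G (z + t)) ((q + lam) * G (z + t) - lam * F (z + t)) t := by
      simpa using (hG (z + t)).comp_const_add z t
    have h2 : HasDerivAt (fun t : ℝ => Real.exp (-((q + lam) * t)))
        (Real.exp (-((q + lam) * t)) * -(q + lam)) t := by
      have := ((hasDerivAt_id t).const_mul (q + lam)).neg.exp
      simpa using this
    refine (h2.mul h1).neg.congr_deriv ?_
    simp only [hg]
    ring
  rw [intervalIntegral.integral_eq_sub_of_hasDerivAt hd (hgc.intervalIntegrable _ _)]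
  have h3 : Real.exp (-((q + lam) * (y - z))) =
      Real.exp (-(q * (y - z))) * Real.exp (-lam * (y - z)) := by
    rw [← Real.exp_add]; congr 1; ring
  rw [h3]
  simp only [add_sub_cancel, hGy, mul_zero, neg_zero, Real.exp_zero, add_zero]
  field_simp
  ring

/-- As `ρ ≤ y`, the flow never reaches `y`, so the same kind of antiderivative works on the whole
half-line. Its boundary term at infinity vanishes since the flow tends to `ρ` and `G` is continuous
there; no value at `y` enters. The derivative is given existentially because at `w = ρ` the equation
does not determine it. -/
theorem integral_passageStep_zero {ρ γ lam q y z : ℝ} (hγ : 0 < γ) (hlam : 0 < lam)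
    (hq : 0 ≤ q) (hρ : ρ ≤ y) (hz : z < y) {F G : ℝ → ℝ} (hF : Continuous F)
    (hG : ∀ w, ∃ d, HasDerivAt G d w ∧ γ * (ρ - w) * d = (q + lam) * G w - lam * F w) :
    ∫ t, passageStep ρ γ y q 0 F z t ∂expMeasure lam = G z := by
  have hk : 0 < q + lam := by linarith
  set g : ℝ → ℝ := fun t => lam * Real.exp (-((q + lam) * t)) * F (kacFlow ρ γ 0 z t) with hg
  have e1 : ∀ t ∈ Ioi (0 : ℝ),
      lam * Real.exp (-(lam * t)) * passageStep ρ γ y q 0 F z t = g t := by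
    intro t ht
    simp only [passageStep, if_pos (kacFlow_zero_lt hγ hρ hz (le_of_lt ht)), hg]
    rw [show -((q + lam) * t) = -(lam * t) + -(q * t) by ring, Real.exp_add]
    ring
  rw [integral_expMeasure hlam, setIntegral_congr_fun measurableSet_Ioi e1]
  have hflow : ∀ t, HasDerivAt (fun t => kacFlow ρ γ 0 z t)
      (γ * (ρ - kacFlow ρ γ 0 z t)) t := by
    intro t
    have h := (((hasDerivAt_id t).const_mul γ).neg.exp.const_mul (z - ρ)).const_add ρ
    simp only [kacFlow_zero]
    refine h.congr_deriv ?_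
    simp
    ring
  have hflowc : Continuous fun t => kacFlow ρ γ 0 z t :=
    continuous_iff_continuousAt.2 fun t => (hflow t).continuousAt
  have hd : ∀ t ∈ Ici (0 : ℝ), HasDerivAt
      (fun t => -(Real.exp (-((q + lam) * t)) * G (kacFlow ρ γ 0 z t))) (g t) t := by
    intro t _
    obtain ⟨d, hd, hd'⟩ := hG (kacFlow ρ γ 0 z t)
    have h1 := hd.comp t (hflow t)
    have h2 : HasDerivAt (fun t : ℝ => Real.exp (-((q + lam) * t)))
        (Real.exp (-((q + lam) * t)) * -(q + lam)) t := by
      have := ((hasDerivAt_id t).const_mul (q + lam)).neg.exp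
      simpa using this
    refine (h2.mul h1).neg.congr_deriv ?_
    simp only [hg, Function.comp_apply]
    linear_combination (-Real.exp (-((q + lam) * t))) * hd'
  have hGc : Continuous G := continuous_iff_continuousAt.2 fun w => by
    obtain ⟨d, hd, -⟩ := hG w
    exact hd.continuousAt
  have hexp : ∀ c : ℝ, 0 < c → Tendsto (fun t : ℝ => Real.exp (-(c * t))) atTop (𝓝 0) :=
    fun c hc => Real.tendsto_exp_neg_atTop_nhds_zero.comp (tendsto_id.const_mul_atTop hc)
  have hlim : Tendsto (fun t => kacFlow ρ γ 0 z t) atTop (𝓝 ρ) := by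
    simpa using ((hexp γ hγ).const_mul (z - ρ)).const_add ρ
  have hint : IntegrableOn g (Ioi 0) := by
    obtain ⟨C, hC⟩ := isCompact_uIcc.exists_bound_of_continuousOn
      (s := uIcc ρ z) hF.continuousOn
    have hb : IntegrableOn (fun t => lam * C * Real.exp (-(q + lam) * t)) (Ioi 0) :=
      (exp_neg_integrableOn_Ioi _ hk).const_mul _
    refine Integrable.mono' hb
      (by fun_prop : Continuous g).aestronglyMeasurable ?_
    refine (ae_restrict_iff' measurableSet_Ioi).2 (Eventually.of_forall fun t ht => ?_)
    -- The flow stays between its start and `ρ`, so only the bound of `F` on that compact interval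
    -- is needed.
    have hmem : kacFlow ρ γ 0 z t ∈ uIcc ρ z := by
      have h1 : Real.exp (-(γ * t)) ≤ 1 :=
        Real.exp_le_one_iff.2 (by have := mul_pos hγ (mem_Ioi.1 ht); linarith)
      have h2 := Real.exp_pos (-(γ * t))
      rw [kacFlow_zero, mem_uIcc]
      rcases le_total ρ z with h | h
      · left; constructor <;> nlinarith
      · right; constructor <;> nlinarith
    have h3 := hC _ hmem
    simp only [hg, norm_mul, Real.norm_eq_abs, Real.abs_exp, abs_of_pos hlam] at h3 ⊢
    rw [neg_mul]
    calc lam * Real.exp (-((q + lam) * t)) * |F (kacFlow ρ γ 0 z t)|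
        ≤ lam * Real.exp (-((q + lam) * t)) * C := by gcongr
      _ = _ := by ring
  rw [integral_Ioi_of_hasDerivAt_of_tendsto' hd hint
    (m := 0) (by
      simpa using ((hexp _ hk).mul ((hGc.tendsto ρ).comp hlim)).neg)]
  simp

/-- The probability of an exponential holding time ending before a unit-speed motion has covered
a distance of at most `h`. -/
theorem measureReal_expMeasure_Iio_le {lam h h' : ℝ} (hlam : 0 < lam) (hh : 0 ≤ h')
    (hle : h ≤ h') : (expMeasure lam).real (Iio h) ≤ 1 - Real.exp (-(lam * h')) := by
  have := isProbabilityMeasure_expMeasure hlam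
  calc (expMeasure lam).real (Iio h) ≤ (expMeasure lam).real (Iic h') :=
        measureReal_mono fun t ht => (le_of_lt (mem_Iio.1 ht)).trans hle
    _ = 1 - Real.exp (-(lam * h')) := by
        rw [← cdf_eq_real, cdf_expMeasure_eq hlam, if_pos hh]

end OneStep

/-! ### Recursions driven by independent innovations -/

section Recursion

open Filter Topology

variable {Ω E : Type*} [MeasurableSpace Ω] [MeasurableSpace E] {P : Measure Ω}

/-- The state of a random recursion driven by independent innovations is measurable and
independent of the next innovation. -/
theorem measurable_and_indepFun_of_recursion {τ : ℕ → Ω → ℝ} (hm : ∀ n, Measurable (τ n))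
    (hi : iIndepFun τ P) {W : ℕ → Ω → E} {f : ℕ → E × ℝ → E} (hf : ∀ n, Measurable (f n)) {e : E}
    (h0 : ∀ ω, W 0 ω = e) (hW : ∀ n ω, W (n + 1) ω = f n (W n ω, τ n ω)) (n : ℕ) :
    Measurable (W n) ∧ IndepFun (W n) (τ n) P := by
  set σ : ℕ → MeasurableSpace Ω := fun k => MeasurableSpace.comap (τ k) inferInstance with hσ
  have hle : ∀ k, σ k ≤ ‹MeasurableSpace Ω› := fun k => (hm k).comap_le
  -- `W n` depends only on the innovations with index below `n`; independence from `τ n` is then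
  -- independence over disjoint index sets.
  have key : ∀ n, Measurable[⨆ k ∈ {k | k < n}, σ k] (W n) := by
    intro n
    induction n with
    | zero =>
      rw [show W 0 = fun _ => e from funext h0]
      exact measurable_const
    | succ n ih =>
      have h1 : Measurable[⨆ k ∈ {k | k < n + 1}, σ k] (W n) :=
        ih.mono (biSup_mono fun k hk => Nat.lt_succ_of_lt hk) le_rfl
      have h2 : Measurable[⨆ k ∈ {k | k < n + 1}, σ k] (τ n) :=
        (comap_measurable (τ n)).mono
          (le_biSup (f := fun k => σ k) (show n ∈ {k | k < n + 1} from Nat.lt_succ_self n)) le_rfl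
      rw [show W (n + 1) = fun ω => f n (W n ω, τ n ω) from funext (hW n)]
      exact (hf n).comp (Measurable.prodMk h1 h2)
  refine ⟨(key n).mono (iSup₂_le fun k _ => hle k) le_rfl, ?_⟩
  have hd : Disjoint {k | k < n} ({n} : Set ℕ) := by simp
  have h := indep_iSup_of_disjoint hle hi.iIndep hd
  rw [IndepFun_iff_Indep]
  refine indep_of_indep_of_le_left (indep_of_indep_of_le_right h ?_) (key n).comap_le
  simp [hσ]

/-- Conditioning on one of two independent variables. -/
theorem integral_comp_of_indepFun [IsProbabilityMeasure P] {W : Ω → E} {T : Ω → ℝ}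
    (hW : Measurable W) (hT : Measurable T) (h : IndepFun W T P) {φ : E × ℝ → ℝ}
    (hφ : Measurable φ) (hint : Integrable (fun ω => φ (W ω, T ω)) P) :
    ∫ ω, φ (W ω, T ω) ∂P = ∫ ω, ∫ t, φ (W ω, t) ∂(P.map T) ∂P := by
  have : IsProbabilityMeasure (P.map W) := Measure.isProbabilityMeasure_map hW.aemeasurable
  have : IsProbabilityMeasure (P.map T) := Measure.isProbabilityMeasure_map hT.aemeasurable
  have hmap := (indepFun_iff_map_prod_eq_prod_map_map hW.aemeasurable hT.aemeasurable).1 h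
  have h1 : ∫ ω, φ (W ω, T ω) ∂P = ∫ p, φ p ∂(P.map fun ω => (W ω, T ω)) :=
    (integral_map (hW.prodMk hT).aemeasurable hφ.aestronglyMeasurable).symm
  have hint' : Integrable φ (P.map fun ω => (W ω, T ω)) :=
    (integrable_map_measure hφ.aestronglyMeasurable (hW.prodMk hT).aemeasurable).2 hint
  rw [hmap] at h1 hint'
  rw [h1, integral_prod _ hint', integral_map hW.aemeasurable]
  exact (hφ.stronglyMeasurable.integral_prod_right').aestronglyMeasurable

end Recursion

/-! ### The process at its switching times, with discounting and rewards -/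

section Skeleton

open Filter Topology

theorem stateAfter_succ (i : Fin 2) (n : ℕ) : stateAfter i (n + 1) = 1 - stateAfter i n := by
  unfold stateAfter
  by_cases h : Even n <;> simp [h, Nat.even_add_one]

/-- The level of the process with holding times `s 0, s 1, …` after `n` switches. -/
noncomputable def skeleton (ρ γ : ℝ) (i : Fin 2) (x : ℝ) (s : ℕ → ℝ) : ℕ → ℝ
  | 0 => x
  | n + 1 => kacFlow ρ γ (stateAfter i n) (skeleton ρ γ i x s n) (s n)

open Classical in
/-- The discount factor at the `n`-th switch, killed once the level `y` has been crossed. -/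
noncomputable def discount (ρ γ y : ℝ) (i : Fin 2) (x q : ℝ) (s : ℕ → ℝ) (n : ℕ) : ℝ :=
  if ∀ k ≤ n, skeleton ρ γ i x s k < y then Real.exp (-(q * ∑ k ∈ Finset.range n, s k)) else 0

/-- The discounted reward `1` for crossing the level `y` before the `n`-th switch. -/
noncomputable def reward (ρ γ y : ℝ) (i : Fin 2) (x q : ℝ) (s : ℕ → ℝ) (n : ℕ) : ℝ :=
  ∑ k ∈ Finset.range n, discount ρ γ y i x q s k *
    if skeleton ρ γ i x s (k + 1) < y then 0 else Real.exp (-(q * (y - skeleton ρ γ i x s k)))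

variable {ρ γ y : ℝ} {i : Fin 2} {x q : ℝ} {s : ℕ → ℝ}

theorem discount_zero (hx : x < y) : discount ρ γ y i x q s 0 = 1 := by
  simp [discount, skeleton, hx]

theorem discount_succ (n : ℕ) : discount ρ γ y i x q s (n + 1) =
    if skeleton ρ γ i x s (n + 1) < y then discount ρ γ y i x q s n * Real.exp (-(q * s n))
    else 0 := by
  have h : (∀ k ≤ n + 1, skeleton ρ γ i x s k < y) ↔
      (∀ k ≤ n, skeleton ρ γ i x s k < y) ∧ skeleton ρ γ i x s (n + 1) < y := by
    constructor
    · exact fun h => ⟨fun k hk => h k (by omega), h _ le_rfl⟩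
    · rintro ⟨h1, h2⟩ k hk
      rcases Nat.le_succ_iff.1 hk with hk | rfl
      exacts [h1 k hk, h2]
  unfold discount
  rw [Finset.sum_range_succ, mul_add, neg_add, Real.exp_add]
  split_ifs with h1 h2 h3 h3 <;> first | rfl | (exfalso; tauto) | simp

theorem discount_nonneg (n : ℕ) : 0 ≤ discount ρ γ y i x q s n := by
  unfold discount
  split_ifs <;> positivity

theorem lt_of_discount_ne_zero {n : ℕ} (h : discount ρ γ y i x q s n ≠ 0) :
    skeleton ρ γ i x s n < y := by
  by_contra hn
  exact h (if_neg fun hk => hn (hk n le_rfl))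

/-- At rate `0` the discount is the indicator that no crossing has been seen up to the `n`-th
switch, so survival probabilities dominate the discounts at every rate `q ≥ 0`. -/
theorem discount_le_discount_zero (hq : 0 ≤ q) (hs : ∀ n, 0 < s n) (n : ℕ) :
    discount ρ γ y i x q s n ≤ discount ρ γ y i x 0 s n := by
  unfold discount
  have : 0 ≤ ∑ k ∈ Finset.range n, s k := Finset.sum_nonneg fun k _ => (hs k).le
  split_ifs
  · simp only [zero_mul, neg_zero, Real.exp_zero]
    exact Real.exp_le_one_iff.2 (by nlinarith)
  · exact le_rfl

theorem discount_zero_rate_le_one (n : ℕ) : discount ρ γ y i x 0 s n ≤ 1 := by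
  unfold discount
  split_ifs <;> simp

theorem le_skeleton {m : ℝ} (hγ : 0 < γ) (hρ : m ≤ ρ) (hx : m ≤ x) (hs : ∀ n, 0 < s n) (n : ℕ) :
    m ≤ skeleton ρ γ i x s n := by
  induction n with
  | zero => exact hx
  | succ n ih => exact le_kacFlow hγ hρ ih (hs n).le _

theorem reward_succ (n : ℕ) : reward ρ γ y i x q s (n + 1) = reward ρ γ y i x q s n +
    discount ρ γ y i x q s n * if skeleton ρ γ i x s (n + 1) < y then 0
      else Real.exp (-(q * (y - skeleton ρ γ i x s n))) :=
  Finset.sum_range_succ _ _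

theorem reward_nonneg (n : ℕ) : 0 ≤ reward ρ γ y i x q s n :=
  Finset.sum_nonneg fun k _ => mul_nonneg (discount_nonneg k) (by split_ifs <;> positivity)

/-- At each step the current discount passes either to the next discount or to the reward, in both
cases multiplied by a factor at most `1`. -/
theorem reward_add_discount_le_one (hq : 0 ≤ q) (hs : ∀ n, 0 < s n) (hx : x < y) (n : ℕ) :
    reward ρ γ y i x q s n + discount ρ γ y i x q s n ≤ 1 := by
  induction n with
  | zero => simp [reward, discount_zero hx]
  | succ n ih =>
    rw [reward_succ, discount_succ]
    have h0 := discount_nonneg (ρ := ρ) (γ := γ) (y := y) (i := i) (x := x) (q := q) (s := s) n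
    by_cases hd : discount ρ γ y i x q s n = 0
    · rw [hd] at ih ⊢
      simpa using ih
    · have hz := lt_of_discount_ne_zero hd
      have e1 : Real.exp (-(q * s n)) ≤ 1 := Real.exp_le_one_iff.2 (by nlinarith [hs n])
      have e2 : Real.exp (-(q * (y - skeleton ρ γ i x s n))) ≤ 1 :=
        Real.exp_le_one_iff.2 (by nlinarith)
      split_ifs <;> nlinarith

theorem reward_le_one (hq : 0 ≤ q) (hs : ∀ n, 0 < s n) (hx : x < y) (n : ℕ) :
    reward ρ γ y i x q s n ≤ 1 := by
  have := discount_nonneg (ρ := ρ) (γ := γ) (y := y) (i := i) (x := x) (q := q) (s := s) n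
  linarith [reward_add_discount_le_one (ρ := ρ) (γ := γ) (i := i) hq hs hx n]

/-- One step of the reward process extended by a terminal reward `F`. -/
theorem discount_mul_add_reward_succ (F : ℝ → ℝ) (n : ℕ) :
    discount ρ γ y i x q s (n + 1) * F (skeleton ρ γ i x s (n + 1)) +
        reward ρ γ y i x q s (n + 1) =
      reward ρ γ y i x q s n + discount ρ γ y i x q s n *
        passageStep ρ γ y q (stateAfter i n) F (skeleton ρ γ i x s n) (s n) := by
  rw [discount_succ, reward_succ]
  unfold passageStep
  rw [show kacFlow ρ γ (stateAfter i n) (skeleton ρ γ i x s n) (s n) =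
    skeleton ρ γ i x s (n + 1) from rfl]
  split_ifs <;> ring

end Skeleton

/-! ### Survival probabilities and the verification argument -/

section Expectation

open Filter Topology

variable {Ω : Type*} [MeasurableSpace Ω] {P : Measure Ω}
  {lam : Fin 2 → ℝ} {ρ γ y : ℝ} {i : Fin 2} {x q : ℝ} {τ : ℕ → Ω → ℝ}

/-- Discount and level together form a recursion: the next pair is a function of the current pair
and the current holding time only. -/
theorem measurable_and_indepFun_skeleton (hm : ∀ n, Measurable (τ n)) (hi : iIndepFun τ P)
    (hx : x < y) (n : ℕ) :
    Measurable (fun ω => (discount ρ γ y i x q (fun k => τ k ω) n,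
        skeleton ρ γ i x (fun k => τ k ω) n)) ∧
      IndepFun (fun ω => (discount ρ γ y i x q (fun k => τ k ω) n,
        skeleton ρ γ i x (fun k => τ k ω) n)) (τ n) P := by
  refine measurable_and_indepFun_of_recursion (e := ((1 : ℝ), x))
    (W := fun n ω => (discount ρ γ y i x q (fun k => τ k ω) n,
        skeleton ρ γ i x (fun k => τ k ω) n))
    (f := fun n p => (if kacFlow ρ γ (stateAfter i n) p.1.2 p.2 < y then
      p.1.1 * Real.exp (-(q * p.2)) else 0, kacFlow ρ γ (stateAfter i n) p.1.2 p.2))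
    hm hi (fun n => ?_) (fun ω => ?_) (fun n ω => ?_) n
  · have h : Measurable fun p : (ℝ × ℝ) × ℝ => kacFlow ρ γ (stateAfter i n) p.1.2 p.2 :=
      (measurable_kacFlow ρ γ _).comp (by fun_prop : Measurable fun p : (ℝ × ℝ) × ℝ => (p.1.2, p.2))
    exact (Measurable.ite (measurableSet_lt h measurable_const) (by fun_prop)
      measurable_const).prodMk h
  · exact Prod.ext (discount_zero hx) rfl
  · exact Prod.ext (discount_succ n) rfl

theorem measurable_discount (hm : ∀ n, Measurable (τ n)) (hi : iIndepFun τ P) (hx : x < y)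
    (n : ℕ) : Measurable fun ω => discount ρ γ y i x q (fun k => τ k ω) n :=
  measurable_fst.comp (measurable_and_indepFun_skeleton hm hi hx n).1

theorem measurable_skeleton (hm : ∀ n, Measurable (τ n)) (n : ℕ) :
    Measurable fun ω => skeleton ρ γ i x (fun k => τ k ω) n := by
  induction n with
  | zero => exact measurable_const
  | succ n ih => exact (measurable_kacFlow ρ γ _).comp (ih.prodMk (hm n))

theorem measurable_reward (hm : ∀ n, Measurable (τ n)) (hi : iIndepFun τ P) (hx : x < y)
    (n : ℕ) : Measurable fun ω => reward ρ γ y i x q (fun k => τ k ω) n := by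
  refine Finset.measurable_sum _ fun k _ => (measurable_discount hm hi hx k).mul
    (Measurable.ite (measurableSet_lt (measurable_skeleton hm (k + 1)) measurable_const)
      measurable_const ?_)
  have := measurable_skeleton (ρ := ρ) (γ := γ) (i := i) (x := x) hm k
  fun_prop

variable [IsProbabilityMeasure P]

theorem integrable_discount_zero (hm : ∀ n, Measurable (τ n)) (hi : iIndepFun τ P) (hx : x < y)
    (n : ℕ) : Integrable (fun ω => discount ρ γ y i x 0 (fun k => τ k ω) n) P := by
  refine Integrable.of_bound (measurable_discount hm hi hx n).aestronglyMeasurable 1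
    (Eventually.of_forall fun ω => ?_)
  rw [Real.norm_eq_abs, abs_of_nonneg (discount_nonneg n)]
  exact discount_zero_rate_le_one n

theorem integrable_reward (hm : ∀ n, Measurable (τ n)) (hpos : ∀ n ω, 0 < τ n ω)
    (hi : iIndepFun τ P) (hx : x < y) (hq : 0 ≤ q) (n : ℕ) :
    Integrable (fun ω => reward ρ γ y i x q (fun k => τ k ω) n) P := by
  refine Integrable.of_bound (measurable_reward hm hi hx n).aestronglyMeasurable 1
    (Eventually.of_forall fun ω => ?_)
  rw [Real.norm_eq_abs, abs_of_nonneg (reward_nonneg n)]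
  exact reward_le_one hq (fun k => hpos k ω) hx n

theorem integral_discount_zero_succ_le (hm : ∀ n, Measurable (τ n)) (hi : iIndepFun τ P)
    (hx : x < y) (n : ℕ) :
    ∫ ω, discount ρ γ y i x 0 (fun k => τ k ω) (n + 1) ∂P ≤
      ∫ ω, discount ρ γ y i x 0 (fun k => τ k ω) n ∂P := by
  refine integral_mono (integrable_discount_zero hm hi hx _)
    (integrable_discount_zero hm hi hx _) fun ω => ?_
  simp only [discount_succ]
  split_ifs
  · simp
  · exact discount_nonneg n

/-- A holding time in state `1` crosses the level with probability bounded below. -/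
theorem integral_discount_zero_succ_le_mul {m : ℝ} (hm : ∀ n, Measurable (τ n))
    (hpos : ∀ n ω, 0 < τ n ω) (hi : iIndepFun τ P)
    (hlaw : ∀ n, P.map (τ n) = expMeasure (lam (stateAfter i n))) (hlam : ∀ j, 0 < lam j)
    (hγ : 0 < γ) (hx : x < y) (hmρ : m ≤ ρ) (hmx : m ≤ x) {n : ℕ} (hn : stateAfter i n = 1) :
    ∫ ω, discount ρ γ y i x 0 (fun k => τ k ω) (n + 1) ∂P ≤
      (1 - Real.exp (-(lam 1 * (y - m)))) *
        ∫ ω, discount ρ γ y i x 0 (fun k => τ k ω) n ∂P := by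
  obtain ⟨hW, hind⟩ := measurable_and_indepFun_skeleton (ρ := ρ) (γ := γ) (y := y) (i := i)
    (x := x) (q := 0) hm hi hx n
  have hp := isProbabilityMeasure_expMeasure (hlam 1)
  have hφ : Measurable fun p : (ℝ × ℝ) × ℝ => p.1.1 * if p.1.2 + p.2 < y then (1 : ℝ) else 0 :=
    (by fun_prop : Measurable fun p : (ℝ × ℝ) × ℝ => p.1.1).mul
      (Measurable.ite (measurableSet_lt (by fun_prop) measurable_const) measurable_const
        measurable_const)
  have e : ∀ ω, discount ρ γ y i x 0 (fun k => τ k ω) (n + 1) =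
      discount ρ γ y i x 0 (fun k => τ k ω) n *
        if skeleton ρ γ i x (fun k => τ k ω) n + τ n ω < y then (1 : ℝ) else 0 := by
    intro ω
    rw [discount_succ, show skeleton ρ γ i x (fun k => τ k ω) (n + 1) =
      skeleton ρ γ i x (fun k => τ k ω) n + τ n ω by rw [skeleton, hn, kacFlow_one]]
    split_ifs <;> simp
  have h := integral_comp_of_indepFun hW (hm n) hind hφ
    ((integrable_discount_zero hm hi hx (n + 1)).congr (Eventually.of_forall e))
  rw [integral_congr_ae (Eventually.of_forall e), h, ← integral_const_mul, hlaw, hn]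
  have inner : ∀ z : ℝ, ∫ t, (if z + t < y then (1 : ℝ) else 0) ∂expMeasure (lam 1) =
      (expMeasure (lam 1)).real (Set.Iio (y - z)) := by
    intro z
    rw [← integral_indicator_one measurableSet_Iio]
    refine integral_congr_ae (Eventually.of_forall fun t => ?_)
    simp only [Set.indicator, Set.mem_Iio, lt_sub_iff_add_lt', Pi.one_apply]
  refine integral_mono_of_nonneg (Eventually.of_forall fun ω => ?_)
    ((integrable_discount_zero hm hi hx n).const_mul _) (Eventually.of_forall fun ω => ?_)
  · refine integral_nonneg fun t => mul_nonneg (discount_nonneg n) ?_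
    split_ifs <;> simp
  · have hz := le_skeleton (i := i) hγ hmρ hmx (fun k => hpos k ω) n
    simp only [integral_const_mul, inner]
    rw [mul_comm]
    refine mul_le_mul_of_nonneg_right ?_ (discount_nonneg n)
    exact measureReal_expMeasure_Iio_le (hlam 1) (by linarith) (by linarith)

/-- Survival probabilities decrease and shrink by a fixed factor below `1` over each state-`1`
holding time, which occurs in any two consecutive steps. -/
theorem tendsto_integral_discount_zero (hm : ∀ n, Measurable (τ n))
    (hpos : ∀ n ω, 0 < τ n ω) (hi : iIndepFun τ P)
    (hlaw : ∀ n, P.map (τ n) = expMeasure (lam (stateAfter i n))) (hlam : ∀ j, 0 < lam j)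
    (hγ : 0 < γ) (hx : x < y) :
    Tendsto (fun n => ∫ ω, discount ρ γ y i x 0 (fun k => τ k ω) n ∂P) atTop (𝓝 0) := by
  set d : ℕ → ℝ := fun n => ∫ ω, discount ρ γ y i x 0 (fun k => τ k ω) n ∂P with hd
  set κ : ℝ := 1 - Real.exp (-(lam 1 * (y - min x ρ))) with hκ
  have hmx := min_le_left x ρ
  have hκ0 : 0 ≤ κ := by
    have : Real.exp (-(lam 1 * (y - min x ρ))) ≤ 1 :=
      Real.exp_le_one_iff.2 (by have := mul_pos (hlam 1) (by linarith : 0 < y - min x ρ); linarith)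
    linarith
  have hκ1 : κ < 1 := by linarith [Real.exp_pos (-(lam 1 * (y - min x ρ)))]
  have hanti : Antitone d := antitone_nat_of_succ_le fun n =>
    integral_discount_zero_succ_le hm hi hx n
  have hd0 : ∀ n, 0 ≤ d n := fun n => integral_nonneg fun ω => discount_nonneg n
  have hstep : ∀ n, stateAfter i n = 1 → d (n + 1) ≤ κ * d n := fun n hn =>
    integral_discount_zero_succ_le_mul hm hpos hi hlaw hlam hγ hx (min_le_right _ _) hmx hn
  have htwo : ∀ n, d (n + 2) ≤ κ * d n := by
    intro n
    by_cases hn : stateAfter i n = 1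
    · exact (hanti (Nat.le_succ (n + 1))).trans (hstep n hn)
    · refine (hstep (n + 1) ?_).trans (mul_le_mul_of_nonneg_left (hanti (Nat.le_succ n)) hκ0)
      rw [stateAfter_succ]
      revert hn
      generalize stateAfter i n = j
      decide +revert
  have hpow : ∀ k, d (2 * k) ≤ κ ^ k * d 0 := by
    intro k
    induction k with
    | zero => simp
    | succ k ih =>
      calc d (2 * (k + 1)) ≤ κ * d (2 * k) := htwo (2 * k)
        _ ≤ κ * (κ ^ k * d 0) := mul_le_mul_of_nonneg_left ih hκ0
        _ = κ ^ (k + 1) * d 0 := by ring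
  have hsub : Tendsto (fun k => d (2 * k)) atTop (𝓝 0) :=
    squeeze_zero (fun k => hd0 _) hpow
      (by simpa using (tendsto_pow_atTop_nhds_zero_of_lt_one hκ0 hκ1).mul_const (d 0))
  -- Monotonicity transfers the decay along even indices to all `n`, through `d n ≤ d (2 * (n /
  -- 2))`.
  refine squeeze_zero hd0 (fun n => hanti (Nat.mul_div_le n 2))
    (hsub.comp (Nat.tendsto_div_const_atTop two_ne_zero))

/-- Almost surely the level is crossed after finitely many switches. -/
theorem ae_exists_le_skeleton (hm : ∀ n, Measurable (τ n))
    (hpos : ∀ n ω, 0 < τ n ω) (hi : iIndepFun τ P)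
    (hlaw : ∀ n, P.map (τ n) = expMeasure (lam (stateAfter i n))) (hlam : ∀ j, 0 < lam j)
    (hγ : 0 < γ) (hx : x < y) :
    ∀ᵐ ω ∂P, ∃ n, y ≤ skeleton ρ γ i x (fun k => τ k ω) n := by
  set A : Set Ω := {ω | ∀ n, skeleton ρ γ i x (fun k => τ k ω) n < y} with hA
  have hAm : MeasurableSet A := by
    rw [hA, Set.ofPred_forall]
    exact MeasurableSet.iInter fun n =>
      measurableSet_lt (measurable_skeleton hm n) measurable_const
  have hle : ∀ n, P.real A ≤ ∫ ω, discount ρ γ y i x 0 (fun k => τ k ω) n ∂P := by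
    intro n
    rw [← integral_indicator_one hAm]
    refine integral_mono ((integrable_const (1 : ℝ)).indicator hAm)
      (integrable_discount_zero hm hi hx n) fun ω => ?_
    by_cases hω : ω ∈ A
    · rw [Set.indicator_of_mem hω]
      simp only [discount]
      rw [if_pos fun k _ => hω k]
      simp
    · rw [Set.indicator_of_notMem hω]
      exact discount_nonneg n
  have h0 : P.real A = 0 := le_antisymm
    (ge_of_tendsto' (tendsto_integral_discount_zero hm hpos hi hlaw hlam hγ hx) hle)
    measureReal_nonneg
  have h1 : P A = 0 := (measureReal_eq_zero_iff).1 h0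
  filter_upwards [compl_mem_ae_iff.2 h1] with ω hω
  simpa [hA] using hω

/-- Verification: a pair of continuous functions that is invariant under the one-step operators is
the limit of the expected discounted rewards. -/
theorem tendsto_integral_reward (hm : ∀ n, Measurable (τ n))
    (hpos : ∀ n ω, 0 < τ n ω) (hi : iIndepFun τ P)
    (hlaw : ∀ n, P.map (τ n) = expMeasure (lam (stateAfter i n))) (hlam : ∀ j, 0 < lam j)
    (hγ : 0 < γ) (hx : x < y) (hq : 0 ≤ q) {F : Fin 2 → ℝ → ℝ} (hF : ∀ j, Continuous (F j))
    (hstep : ∀ j z, z < y →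
      ∫ t, passageStep ρ γ y q j (F (1 - j)) z t ∂expMeasure (lam j) = F j z) :
    Tendsto (fun n => ∫ ω, reward ρ γ y i x q (fun k => τ k ω) n ∂P) atTop (𝓝 (F i x)) := by
  have hmx := min_le_left x ρ
  have hmρ := min_le_right x ρ
  -- As long as the discount is nonzero, the level lies in this compact interval; elsewhere no bound
  -- on `F` is needed.
  choose B hB using fun j : Fin 2 => (isCompact_Icc (a := min x ρ) (b := y)).exists_bound_of_continuousOn
    (hF j).continuousOn
  set C : ℝ := max (B 0) (B 1) with hC
  have hBC : ∀ j, B j ≤ C := by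
    intro j
    fin_cases j
    exacts [le_max_left _ _, le_max_right _ _]
  set V : ℕ → Ω → ℝ := fun n ω => discount ρ γ y i x q (fun k => τ k ω) n *
    F (stateAfter i n) (skeleton ρ γ i x (fun k => τ k ω) n) with hV
  have hVle : ∀ n ω, ‖V n ω‖ ≤ C * discount ρ γ y i x 0 (fun k => τ k ω) n := by
    intro n ω
    have h0 := discount_nonneg (ρ := ρ) (γ := γ) (y := y) (i := i) (x := x) (q := q)
      (s := fun k => τ k ω) n
    have h1 := discount_le_discount_zero (ρ := ρ) (γ := γ) (y := y) (i := i) (x := x) hq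
      (fun k => hpos k ω) n
    have hmem : discount ρ γ y i x q (fun k => τ k ω) n ≠ 0 →
        ‖F (stateAfter i n) (skeleton ρ γ i x (fun k => τ k ω) n)‖ ≤ C := fun hd =>
      (hB _ _ ⟨le_skeleton hγ hmρ hmx (fun k => hpos k ω) n,
        (lt_of_discount_ne_zero hd).le⟩).trans (hBC _)
    by_cases hd : discount ρ γ y i x q (fun k => τ k ω) n = 0
    · have hC0 : 0 ≤ C := (norm_nonneg _).trans
        ((hB 0 x ⟨hmx, hx.le⟩).trans (hBC 0))
      simp only [hV, hd, zero_mul, norm_zero]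
      exact mul_nonneg hC0 (discount_nonneg n)
    · simp only [hV, norm_mul, Real.norm_eq_abs, abs_of_nonneg h0]
      rw [mul_comm]
      exact mul_le_mul (hmem hd) h1 h0 ((norm_nonneg _).trans (hmem hd))
  have hVint : ∀ n, Integrable (V n) P := fun n =>
    Integrable.mono' ((integrable_discount_zero hm hi hx n).const_mul C)
      ((measurable_discount hm hi hx n).mul
        ((hF _).measurable.comp (measurable_skeleton hm n))).aestronglyMeasurable
      (Eventually.of_forall (hVle n))
  -- The conservation law: conditioning on the past replaces the next holding time by its one-step
  -- operator, which leaves the pair `F` invariant.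
  have hsucc : ∀ n, ∫ ω, V (n + 1) ω ∂P + ∫ ω, reward ρ γ y i x q (fun k => τ k ω) (n + 1) ∂P =
      ∫ ω, V n ω ∂P + ∫ ω, reward ρ γ y i x q (fun k => τ k ω) n ∂P := by
    intro n
    obtain ⟨hW, hind⟩ := measurable_and_indepFun_skeleton (ρ := ρ) (γ := γ) (y := y) (i := i)
      (x := x) (q := q) hm hi hx n
    set φ : (ℝ × ℝ) × ℝ → ℝ := fun p => p.1.1 *
      passageStep ρ γ y q (stateAfter i n) (F (stateAfter i (n + 1))) p.1.2 p.2 with hφ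
    have hφm : Measurable φ := by
      have h : Measurable fun p : (ℝ × ℝ) × ℝ => kacFlow ρ γ (stateAfter i n) p.1.2 p.2 :=
        (measurable_kacFlow ρ γ _).comp
          (by fun_prop : Measurable fun p : (ℝ × ℝ) × ℝ => (p.1.2, p.2))
      refine (by fun_prop : Measurable fun p : (ℝ × ℝ) × ℝ => p.1.1).mul
        (Measurable.ite (measurableSet_lt h measurable_const) ?_ (by fun_prop))
      exact (by fun_prop : Measurable fun p : (ℝ × ℝ) × ℝ => Real.exp (-(q * p.2))).mul
        ((hF _).measurable.comp h)
    have e : ∀ ω, V (n + 1) ω + reward ρ γ y i x q (fun k => τ k ω) (n + 1) =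
        reward ρ γ y i x q (fun k => τ k ω) n +
          φ ((discount ρ γ y i x q (fun k => τ k ω) n,
            skeleton ρ γ i x (fun k => τ k ω) n), τ n ω) := fun ω =>
      discount_mul_add_reward_succ (F (stateAfter i (n + 1))) n
    have hr := fun n => integrable_reward (ρ := ρ) (γ := γ) (i := i) hm hpos hi hx hq n
    have hφint : Integrable (fun ω => φ ((discount ρ γ y i x q (fun k => τ k ω) n,
        skeleton ρ γ i x (fun k => τ k ω) n), τ n ω)) P := by
      refine (((hVint (n + 1)).add (hr (n + 1))).sub (hr n)).congr
        (Eventually.of_forall fun ω => ?_)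
      simp only [Pi.add_apply, Pi.sub_apply]
      linarith [e ω]
    rw [← integral_add (hVint _) (hr _), integral_congr_ae (Eventually.of_forall e),
      integral_add (hr n) hφint, integral_comp_of_indepFun hW (hm n) hind hφm hφint, hlaw,
      add_comm]
    congr 1
    refine integral_congr_ae (Eventually.of_forall fun ω => ?_)
    simp only [hφ, integral_const_mul, hV]
    -- The one-step equation is available only below `y`; otherwise the discount is zero and both
    -- sides vanish.
    by_cases hd : discount ρ γ y i x q (fun k => τ k ω) n = 0
    · simp [hd]
    · rw [stateAfter_succ, hstep _ _ (lt_of_discount_ne_zero hd)]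
  have hconst : ∀ n, ∫ ω, V n ω ∂P + ∫ ω, reward ρ γ y i x q (fun k => τ k ω) n ∂P = F i x := by
    intro n
    induction n with
    | zero => simp [hV, discount_zero hx, reward, skeleton, stateAfter]
    | succ n ih => rw [hsucc, ih]
  have hV0 : Tendsto (fun n => ∫ ω, V n ω ∂P) atTop (𝓝 0) := by
    refine squeeze_zero_norm (fun n => ?_)
      (by simpa using (tendsto_integral_discount_zero (ρ := ρ) (γ := γ) hm hpos hi hlaw hlam hγ
        hx).const_mul C)
    rw [← integral_const_mul]
    exact norm_integral_le_of_norm_le ((integrable_discount_zero hm hi hx n).const_mul C)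
      (Eventually.of_forall (hVle n))
  have h := hV0.const_sub (F i x)
  rw [sub_zero] at h
  exact h.congr fun n => by linarith [hconst n]

end Expectation

/-! ### Pathwise identification of the first passage time -/

section Path

open Filter Topology Set

/-- The solution of the linear integral equation `u' = a - γ u`. -/
theorem eq_of_linear_integral_equation {u : ℝ → ℝ} {a γ b c : ℝ} (hγ : γ ≠ 0) (hbc : b ≤ c)
    (hu : ContinuousOn u (Icc b c))
    (h : ∀ r ∈ Icc b c, u r = u b + ∫ v in b..r, (a - γ * u v)) :
    ∀ r ∈ Icc b c, u r = a / γ + (u b - a / γ) * Real.exp (-(γ * (r - b))) := by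
  -- Extending `u` continuously to the line makes its primitive `z` differentiable everywhere,
  -- including at the endpoints; `z`, `w` and `u` agree on `[b, c]`.
  set w : ℝ → ℝ := IccExtend hbc (fun v : Icc b c => u v) with hw
  have hwc : Continuous w := (continuousOn_iff_continuous_domRestrict.1 hu).Icc_extend'
  have hwu : ∀ r ∈ Icc b c, w r = u r := fun r hr => IccExtend_of_mem hbc _ hr
  set z : ℝ → ℝ := fun r => u b + ∫ v in b..r, (a - γ * w v) with hz
  have hzu : ∀ r ∈ Icc b c, z r = u r := by
    intro r hr
    rw [h r hr, hz]
    simp only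
    congr 1
    refine intervalIntegral.integral_congr fun v hv => ?_
    rw [uIcc_of_le hr.1] at hv
    rw [hwu v ⟨hv.1, hv.2.trans hr.2⟩]
  have hzd : ∀ r, HasDerivAt z (a - γ * w r) r := fun r =>
    ((by fun_prop : Continuous fun v => a - γ * w v).integral_hasStrictDerivAt b r).hasDerivAt.const_add _
  -- Integrating factor: the derivative vanishes on `[b, c]`, where `z = w`.
  have hd : ∀ r, HasDerivAt (fun r => Real.exp (γ * (r - b)) * (z r - a / γ))
      (Real.exp (γ * (r - b)) * (γ * (z r - w r))) r := by
    intro r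
    have h1 : HasDerivAt (fun r => Real.exp (γ * (r - b))) (Real.exp (γ * (r - b)) * γ) r := by
      simpa using (((hasDerivAt_id r).sub_const b).const_mul γ).exp
    refine (h1.mul ((hzd r).sub_const (a / γ))).congr_deriv ?_
    field_simp
    ring
  have hconst := constant_of_has_deriv_right_zero (a := b) (b := c)
    (f := fun r => Real.exp (γ * (r - b)) * (z r - a / γ))
    (fun r _ => (hd r).continuousAt.continuousWithinAt) fun r hr => by
      have hr' : r ∈ Icc b c := ⟨hr.1, hr.2.le⟩
      have := (hd r).hasDerivWithinAt (s := Ici r)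
      rwa [hzu r hr', hwu r hr', sub_self, mul_zero, mul_zero] at this
  intro r hr
  have := hconst r hr
  simp only [sub_self, mul_zero, Real.exp_zero, one_mul] at this
  rw [hzu r hr, hzu b ⟨le_rfl, hbc⟩] at this
  rw [← this, Real.exp_neg]
  have := Real.exp_pos (γ * (r - b))
  field_simp
  ring

variable {a₀ γ y x : ℝ} {i : Fin 2} {s : ℕ → ℝ} {e : ℝ → Fin 2} {X : ℝ → ℝ}

theorem path_eq_kacFlow (hγ : 0 < γ) (hs : ∀ n, 0 < s n)
    (he : ∀ (n : ℕ) (t : ℝ), ∑ k ∈ Finset.range n, s k ≤ t →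
      t < ∑ k ∈ Finset.range (n + 1), s k → e t = stateAfter i n)
    (hX : ∀ t, 0 ≤ t →
      IntervalIntegrable (fun u => ![a₀, 1] (e u) - ![γ, 0] (e u) * X u) volume 0 t ∧
      X t = x + ∫ u in (0 : ℝ)..t, (![a₀, 1] (e u) - ![γ, 0] (e u) * X u))
    (n : ℕ) {t : ℝ} (ht : 0 ≤ t) (hts : t ≤ s n) :
    X (∑ k ∈ Finset.range n, s k + t) =
      kacFlow (a₀ / γ) γ (stateAfter i n) (X (∑ k ∈ Finset.range n, s k)) t := by
  set g : ℝ → ℝ := fun u => ![a₀, 1] (e u) - ![γ, 0] (e u) * X u with hg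
  set b : ℝ := ∑ k ∈ Finset.range n, s k with hb
  have hb0 : 0 ≤ b := Finset.sum_nonneg fun k _ => (hs k).le
  have heq : ∀ u ∈ Ico b (b + s n), e u = stateAfter i n := fun u hu =>
    he n u hu.1 (by rw [Finset.sum_range_succ]; exact hu.2)
  have hinc : ∀ r ∈ Icc b (b + s n), X r = X b + ∫ u in b..r, g u := by
    intro r hr
    have hr0 : 0 ≤ r := hb0.trans hr.1
    rw [(hX r hr0).2, (hX b hb0).2, add_assoc, intervalIntegral.integral_add_adjacent_intervals
      (hX b hb0).1 ((hX b hb0).1.symm.trans (hX r hr0).1)]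
  -- The state is prescribed only on the half-open holding interval, so the integrals are compared
  -- on open intervals, ignoring the right endpoint.
  have hcongr : ∀ f : ℝ → ℝ, (∀ u ∈ Ico b (b + s n), g u = f u) → ∀ r ∈ Icc b (b + s n),
      X r = X b + ∫ u in b..r, f u := by
    intro f hf r hr
    rw [hinc r hr, intervalIntegral.integral_of_le hr.1, intervalIntegral.integral_of_le hr.1,
      integral_Ioc_eq_integral_Ioo, integral_Ioc_eq_integral_Ioo]
    congr 1
    exact setIntegral_congr_fun measurableSet_Ioo fun u hu =>
      hf u ⟨hu.1.le, hu.2.trans_le hr.2⟩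
  have hmem : b + t ∈ Icc b (b + s n) := ⟨by linarith, by linarith⟩
  rcases (by generalize stateAfter i n = j; decide +revert :
    stateAfter i n = 0 ∨ stateAfter i n = 1) with hj | hj
  -- Continuity of the path comes from its own integral equation, as a primitive of an integrable
  -- function. State `1` does not need it, the integrand there being constant.
  · have hc : ContinuousOn X (Icc b (b + s n)) := by
      have h1 : IntegrableOn g (uIcc 0 (b + s n)) := by
        rw [uIcc_of_le (by linarith [hs n]), integrableOn_Icc_iff_integrableOn_Ioc]
        exact (intervalIntegrable_iff_integrableOn_Ioc_of_le (by linarith [hs n])).1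
          (hX (b + s n) (by linarith [hs n])).1
      have h2 := (intervalIntegral.continuousOn_primitive_interval h1).const_add x
      refine (h2.mono ?_).congr fun r hr => (hX r (hb0.trans hr.1)).2
      rw [uIcc_of_le (by linarith [hs n])]
      exact Icc_subset_Icc_left hb0
    have hlin := eq_of_linear_integral_equation (a := a₀) hγ.ne' (by linarith [hs n]) hc
      (hcongr (fun u => a₀ - γ * X u) fun u hu => by simp [hg, heq u hu, hj])
    rw [hlin _ hmem, hj, kacFlow_zero, add_sub_cancel_left]
  · rw [hcongr (fun _ => 1) (fun u hu => by simp [hg, heq u hu, hj]) _ hmem, hj, kacFlow_one]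
    simp

theorem path_eq_skeleton (hγ : 0 < γ) (hs : ∀ n, 0 < s n)
    (he : ∀ (n : ℕ) (t : ℝ), ∑ k ∈ Finset.range n, s k ≤ t →
      t < ∑ k ∈ Finset.range (n + 1), s k → e t = stateAfter i n)
    (hX : ∀ t, 0 ≤ t →
      IntervalIntegrable (fun u => ![a₀, 1] (e u) - ![γ, 0] (e u) * X u) volume 0 t ∧
      X t = x + ∫ u in (0 : ℝ)..t, (![a₀, 1] (e u) - ![γ, 0] (e u) * X u))
    (n : ℕ) : X (∑ k ∈ Finset.range n, s k) = skeleton (a₀ / γ) γ i x s n := by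
  induction n with
  | zero => simpa [skeleton] using (hX 0 le_rfl).2
  | succ n ih =>
    rw [Finset.sum_range_succ, path_eq_kacFlow hγ hs he hX n (hs n).le le_rfl, ih, skeleton]

/-- Exactly one summand survives: before index `M` nothing is crossed, and after it the discount is
killed. -/
theorem reward_eq_exp {ρ q : ℝ} {M : ℕ} (hlt : ∀ k ≤ M, skeleton ρ γ i x s k < y)
    (hge : y ≤ skeleton ρ γ i x s (M + 1)) {n : ℕ} (hn : M + 1 ≤ n) :
    reward ρ γ y i x q s n =
      Real.exp (-(q * (∑ k ∈ Finset.range M, s k + (y - skeleton ρ γ i x s M)))) := by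
  induction n, hn using Nat.le_induction with
  | base =>
    rw [reward_succ, reward, Finset.sum_eq_zero, if_neg (not_lt.2 hge), discount, if_pos hlt,
      zero_add, ← Real.exp_add]
    · congr 1; ring
    · intro k hk
      rw [if_pos (hlt (k + 1) (Finset.mem_range.1 hk)), mul_zero]
  | succ n hn ih =>
    rw [reward_succ, ih, discount, if_neg fun h => not_lt.2 hge (h _ hn), zero_mul, add_zero]

/-- Along a path whose skeleton crosses the level, the first passage time is finite and the
discounted rewards are eventually equal to its discount factor. -/
theorem exists_iInf_eq_and_eventually_reward_eq (hγ : 0 < γ) (hs : ∀ n, 0 < s n) (hx : x < y)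
    (hy : a₀ / γ ≤ y)
    (he : ∀ (n : ℕ) (t : ℝ), ∑ k ∈ Finset.range n, s k ≤ t →
      t < ∑ k ∈ Finset.range (n + 1), s k → e t = stateAfter i n)
    (hX : ∀ t, 0 ≤ t →
      IntervalIntegrable (fun u => ![a₀, 1] (e u) - ![γ, 0] (e u) * X u) volume 0 t ∧
      X t = x + ∫ u in (0 : ℝ)..t, (![a₀, 1] (e u) - ![γ, 0] (e u) * X u))
    (hcross : ∃ n, y ≤ skeleton (a₀ / γ) γ i x s n) :
    ∃ T : ℝ, 0 ≤ T ∧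
      (⨅ (t : ℝ) (_ : 0 < t ∧ X t = y), ENNReal.ofReal t) = ENNReal.ofReal T ∧
      ∀ q : ℝ, ∀ᶠ n in atTop,
        reward (a₀ / γ) γ y i x q s n = Real.exp (-(q * T)) := by
  classical
  -- The first switch at or above `y` has positive index since `x < y`; thus `M` labels the holding
  -- interval in which the crossing occurs.
  obtain ⟨M, hM⟩ : ∃ M, Nat.find hcross = M + 1 := by
    refine Nat.exists_eq_succ_of_ne_zero fun h => ?_
    have := Nat.find_spec hcross
    rw [h] at this
    exact absurd hx (not_lt.2 this)
  have hge : y ≤ skeleton (a₀ / γ) γ i x s (M + 1) := hM ▸ Nat.find_spec hcross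
  have hlt : ∀ k ≤ M, skeleton (a₀ / γ) γ i x s k < y := fun k hk =>
    not_le.1 (Nat.find_min hcross (by omega))
  have hcases : ∀ n, stateAfter i n = 0 ∨ stateAfter i n = 1 := fun n => by
    generalize stateAfter i n = j
    decide +revert
  -- In state `0` the flow started below `y` stays below it, so the crossing happens under unit
  -- drift, at time `y - skeleton M` into the interval.
  have hj : stateAfter i M = 1 := by
    refine (hcases M).resolve_left fun h => not_lt.2 hge ?_
    rw [skeleton, h]
    exact kacFlow_zero_lt hγ hy (hlt M le_rfl) (hs M).le
  have hsM : y - skeleton (a₀ / γ) γ i x s M ≤ s M := by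
    rw [skeleton, hj, kacFlow_one] at hge
    linarith
  have hpath : ∀ n t, 0 ≤ t → t ≤ s n → X (∑ k ∈ Finset.range n, s k + t) =
      kacFlow (a₀ / γ) γ (stateAfter i n) (skeleton (a₀ / γ) γ i x s n) t := fun n t h0 h1 => by
    rw [path_eq_kacFlow hγ hs he hX n h0 h1, path_eq_skeleton hγ hs he hX]
  -- Checking switching times suffices: state `0` cannot reach `y`, and in state `1` the path
  -- increases to an endpoint that is still below `y`.
  have hbefore : ∀ n ≤ M, ∀ t, 0 ≤ t → t < ∑ k ∈ Finset.range n, s k → X t < y := by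
    intro n
    induction n with
    | zero =>
      intro _ t h0 h1
      simp only [Finset.range_zero, Finset.sum_empty] at h1
      linarith
    | succ n ih =>
      intro hn t h0 h1
      rcases lt_or_ge t (∑ k ∈ Finset.range n, s k) with h | h
      · exact ih (by omega) t h0 h
      · rw [Finset.sum_range_succ] at h1
        have h2 := hpath n (t - ∑ k ∈ Finset.range n, s k) (by linarith) (by linarith)
        rw [add_sub_cancel] at h2
        rw [h2]
        rcases hcases n with hn0 | hn1
        · rw [hn0]
          exact kacFlow_zero_lt hγ hy (hlt n (by omega)) (by linarith)
        · have h3 := hlt (n + 1) hn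
          rw [skeleton, hn1, kacFlow_one] at h3
          rw [hn1, kacFlow_one]
          linarith
  have hM0 := hlt M le_rfl
  have hS0 : 0 ≤ ∑ k ∈ Finset.range M, s k := Finset.sum_nonneg fun k _ => (hs k).le
  have hXT : X (∑ k ∈ Finset.range M, s k + (y - skeleton (a₀ / γ) γ i x s M)) = y := by
    rw [hpath M _ (by linarith) hsM, hj, kacFlow_one]
    ring
  refine ⟨∑ k ∈ Finset.range M, s k + (y - skeleton (a₀ / γ) γ i x s M), by linarith, ?_,
    fun q => (eventually_ge_atTop (M + 1)).mono fun n hn => reward_eq_exp hlt hge hn⟩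
  refine le_antisymm (iInf₂_le _ ⟨by linarith, hXT⟩) (le_iInf₂ fun t ht => ?_)
  · refine ENNReal.ofReal_le_ofReal (le_of_not_gt fun hlt' => ?_)
    refine (ne_of_lt ?_ : X t ≠ y) ht.2
    rcases lt_or_ge t (∑ k ∈ Finset.range M, s k) with h | h
    · exact hbefore M le_rfl t ht.1.le h
    · have h2 := hpath M (t - ∑ k ∈ Finset.range M, s k) (by linarith) (by linarith)
      rw [add_sub_cancel, hj, kacFlow_one] at h2
      rw [h2]
      linarith

end Path

/-! ### From the chain to the Laplace transform -/

section Main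

open Filter Topology

variable {Ω : Type*} [MeasurableSpace Ω] {P : Measure Ω}

/-- The holding times of a two-state Markov chain may be chosen measurable and positive. -/
theorem IsTwoStateMarkovChain.exists_measurable_pos {lam : Fin 2 → ℝ} {i : Fin 2}
    {ε : ℝ → Ω → Fin 2} (h : IsTwoStateMarkovChain P lam i ε) (hlam : ∀ j, 0 < lam j) :
    ∃ τ : ℕ → Ω → ℝ, (∀ n, Measurable (τ n)) ∧ (∀ n ω, 0 < τ n ω) ∧ iIndepFun τ P ∧
      (∀ n, P.map (τ n) = expMeasure (lam (stateAfter i n))) ∧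
      ∀ᵐ ω ∂P, ∀ (n : ℕ) (t : ℝ), ∑ k ∈ Finset.range n, τ k ω ≤ t →
        t < ∑ k ∈ Finset.range (n + 1), τ k ω → ε t ω = stateAfter i n := by
  obtain ⟨τ, hi, hlaw, hε⟩ := h
  have hm := fun n => (hlaw n).aemeasurable
  -- Replaces each holding time by a measurable version, with the default `1` on the null set where
  -- that version is not positive.
  set σ : ℕ → Ω → ℝ := fun n ω => if 0 < (hm n).mk _ ω then (hm n).mk _ ω else 1 with hσ
  have heq : ∀ n, τ n =ᵐ[P] σ n := by
    intro n
    have := isProbabilityMeasure_expMeasure (hlam (stateAfter i n))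
    have h0 : P {ω | τ n ω ≤ 0} = 0 := by
      rw [(hlaw n).measure_eq (p := fun t => t ≤ 0) measurableSet_Iic]
      have h1 := cdf_expMeasure_eq (hlam (stateAfter i n)) 0
      rw [cdf_eq_real] at h1
      refine (measureReal_eq_zero_iff).1 (h1.trans ?_)
      simp
    filter_upwards [(hm n).ae_eq_mk, compl_mem_ae_iff.2 h0] with ω h1 h2
    have h3 : 0 < τ n ω := not_le.1 h2
    simp only [hσ]
    rw [if_pos (h1 ▸ h3), h1]
  refine ⟨σ, fun n => ?_, fun n ω => ?_, hi.congr heq, fun n => ?_, ?_⟩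
  · exact Measurable.ite (measurableSet_lt measurable_const (hm n).measurable_mk)
      (hm n).measurable_mk measurable_const
  · simp only [hσ]
    split_ifs with h
    exacts [h, one_pos]
  · rw [← Measure.map_congr (heq n), (hlaw n).map_eq]
  · filter_upwards [hε, ae_all_iff.2 heq] with ω h1 h2
    simpa only [h2] using h1

variable [IsProbabilityMeasure P]

/-- Verification theorem for the Laplace transform of the first passage time. -/
theorem IsKacOrnsteinUhlenbeck.laplaceOfTime_firstPassageTime {lam : Fin 2 → ℝ} {a₀ γ x y q : ℝ}
    {i : Fin 2} {ε : ℝ → Ω → Fin 2} {X : ℝ → Ω → ℝ}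
    (hX : IsKacOrnsteinUhlenbeck P ![a₀, 1] ![γ, 0] ε x X)
    (hε : IsTwoStateMarkovChain P lam i ε) (hlam : ∀ j, 0 < lam j) (hγ : 0 < γ) (hx : x < y)
    (hy : a₀ / γ ≤ y) (hq : 0 ≤ q) {F : Fin 2 → ℝ → ℝ} (hF : ∀ j, Continuous (F j))
    (hstep : ∀ j z, z < y →
      ∫ t, passageStep (a₀ / γ) γ y q j (F (1 - j)) z t ∂expMeasure (lam j) = F j z) :
    AEMeasurable (firstPassageTime X y) P ∧
      laplaceOfTime P (firstPassageTime X y) q = F i x := by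
  obtain ⟨τ, hm, hpos, hi, hlaw, hτ⟩ := hε.exists_measurable_pos hlam
  have key : ∀ᵐ ω ∂P, ∃ T : ℝ, 0 ≤ T ∧ firstPassageTime X y ω = ENNReal.ofReal T ∧
      ∀ q : ℝ, ∀ᶠ n in atTop,
        reward (a₀ / γ) γ y i x q (fun k => τ k ω) n = Real.exp (-(q * T)) := by
    filter_upwards [hX, hτ, ae_exists_le_skeleton (ρ := a₀ / γ) hm hpos hi hlaw hlam hγ hx]
      with ω h1 h2 h3
    exact exists_iInf_eq_and_eventually_reward_eq (X := fun t => X t ω) (e := fun t => ε t ω)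
      hγ (fun n => hpos n ω) hx hy h2 h1 h3
  constructor
  -- At rate `1` the rewards are eventually `exp (-T)`, so `T` is the almost sure limit of the
  -- measurable functions `-log reward`.
  · refine aemeasurable_of_tendsto_metrizable_ae atTop
      (f := fun n ω => ENNReal.ofReal (-Real.log (reward (a₀ / γ) γ y i x 1 (fun k => τ k ω) n)))
      (fun n => ((measurable_reward hm hi hx n).log.neg.ennreal_ofReal).aemeasurable) ?_
    filter_upwards [key] with ω ⟨T, _, hT, hr⟩
    refine tendsto_const_nhds.congr' ?_
    filter_upwards [hr 1] with n hn
    rw [hn, hT, Real.log_exp, neg_neg, one_mul]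
  · refine tendsto_nhds_unique ?_
      (tendsto_integral_reward hm hpos hi hlaw hlam hγ hx hq hF hstep)
    refine tendsto_integral_of_dominated_convergence (fun _ => 1)
      (fun n => (measurable_reward hm hi hx n).aestronglyMeasurable) (integrable_const _)
      (fun n => Eventually.of_forall fun ω => ?_) ?_
    · rw [Real.norm_eq_abs, abs_of_nonneg (reward_nonneg n)]
      exact reward_le_one hq (fun k => hpos k ω) hx n
    · filter_upwards [key] with ω ⟨T, hT0, hT, hr⟩
      refine tendsto_const_nhds.congr' ?_
      filter_upwards [hr q] with n hn
      have hmem : ω ∈ {ω | firstPassageTime X y ω ≠ ∞} := by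
        rw [Set.mem_ofPred_eq, hT]
        exact ENNReal.ofReal_ne_top
      rw [hn, Set.indicator_of_mem hmem, hT, ENNReal.toReal_ofReal hT0]

end Main

/-- First-passage formula for the Kac-Ornstein-Uhlenbeck process with non-strict attraction. -/
theorem mainTheorem6 {Ω : Type*} [MeasurableSpace Ω] (P : Measure Ω) [IsProbabilityMeasure P]
    (lam₀ lam₁ a₀ γ₀ x y q : ℝ) (hlam₀ : 0 < lam₀) (hlam₁ : 0 < lam₁) (hγ₀ : 0 < γ₀)
    (hxy : x < y) (hy : a₀ / γ₀ ≤ y) (hq : 0 ≤ q)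
    (ε : ℝ → Ω → Fin 2) (X : ℝ → Ω → ℝ)
    (hX : IsKacOrnsteinUhlenbeck P ![a₀, 1] ![γ₀, 0] ε x X) :
    let ρ₀ : ℝ := a₀ / γ₀
    let β₀ : ℝ := (q + lam₀) / γ₀
    let δ : ℝ := ((q + lam₀) * (q + lam₁) - lam₀ * lam₁) / (γ₀ * (q + lam₁))
    confluentHypergeometric δ β₀ ((y - ρ₀) * (q + lam₁)) ≠ 0 ∧
    (IsTwoStateMarkovChain P ![lam₀, lam₁] 0 ε →
      AEMeasurable (firstPassageTime X y) P ∧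
      laplaceOfTime P (firstPassageTime X y) q =
        (lam₀ / γ₀) / β₀ *
          (confluentHypergeometric δ (1 + β₀) ((x - ρ₀) * (q + lam₁)) /
            confluentHypergeometric δ β₀ ((y - ρ₀) * (q + lam₁)))) ∧
    (IsTwoStateMarkovChain P ![lam₀, lam₁] 1 ε →
      AEMeasurable (firstPassageTime X y) P ∧
      laplaceOfTime P (firstPassageTime X y) q =
        confluentHypergeometric δ β₀ ((x - ρ₀) * (q + lam₁)) /
          confluentHypergeometric δ β₀ ((y - ρ₀) * (q + lam₁))) := by
  intro ρ₀ β₀ δ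
  have hk : 0 < q + lam₁ := by linarith
  have hβ : 0 < β₀ := div_pos (by linarith) hγ₀
  have hnum : (q + lam₀) * (q + lam₁) - lam₀ * lam₁ = q * (q + lam₀ + lam₁) := by ring
  have hδ : 0 ≤ δ := by
    simp only [δ, hnum]
    positivity
  -- This value of `β₀ - δ` turns the coefficient `(c - a) / c` of the contiguous relation, times `q
  -- + lam₁`, into `lam₁` times the prefactor of `F 0`. It also yields `δ ≤ β₀`.
  have hβδ : β₀ - δ = lam₀ * lam₁ / (γ₀ * (q + lam₁)) := by
    simp only [β₀, δ]
    field_simp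
    ring
  have hδβ : δ ≤ β₀ := by
    have : 0 < lam₀ * lam₁ / (γ₀ * (q + lam₁)) := by positivity
    linarith
  set D : ℝ := confluentHypergeometric δ β₀ ((y - ρ₀) * (q + lam₁))
  have hDpos : 0 < D := one_pos.trans_le (one_le_confluentHypergeometric hδ hδβ hβ
    (mul_nonneg (sub_nonneg.2 hy) hk.le))
  -- The candidate pair: normalising by `D` gives `F 1 y = 1`, and the prefactor of `F 0` equals
  -- `lam₀ / (q + lam₀)`.
  set F : Fin 2 → ℝ → ℝ := ![
    fun w => (lam₀ / γ₀) / β₀ *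
      (confluentHypergeometric δ (β₀ + 1) ((w - ρ₀) * (q + lam₁)) / D),
    fun w => confluentHypergeometric δ β₀ ((w - ρ₀) * (q + lam₁)) / D] with hF
  have hin : ∀ w, HasDerivAt (fun w : ℝ => (w - ρ₀) * (q + lam₁)) (q + lam₁) w := fun w => by
    simpa using ((hasDerivAt_id w).sub_const ρ₀).mul_const (q + lam₁)
  have hF1 : ∀ w, HasDerivAt (F 1) ((q + lam₁) * F 1 w - lam₁ * F 0 w) w := by
    intro w
    have h := ((hasDerivAt_confluentHypergeometric hδ hδβ hβ _).comp w (hin w)).div_const D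
    refine h.congr_deriv ?_
    rw [hβδ]
    simp only [hF, Matrix.cons_val_zero, Matrix.cons_val_one]
    field_simp
  have hF0 : ∀ w, ∃ d, HasDerivAt (F 0) d w ∧
      γ₀ * (ρ₀ - w) * d = (q + lam₀) * F 0 w - lam₀ * F 1 w := by
    intro w
    obtain ⟨d, hd, hd'⟩ := exists_hasDerivAt_confluentHypergeometric_add_one hδ hδβ hβ
      ((w - ρ₀) * (q + lam₁))
    refine ⟨_, ((hd.comp w (hin w)).div_const D).const_mul ((lam₀ / γ₀) / β₀), ?_⟩
    have hq0 : q + lam₀ = β₀ * γ₀ := by simp only [β₀]; field_simp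
    rw [hq0]
    simp only [hF, Matrix.cons_val_zero, Matrix.cons_val_one]
    generalize confluentHypergeometric δ (β₀ + 1) ((w - ρ₀) * (q + lam₁)) = A at hd' ⊢
    generalize confluentHypergeometric δ β₀ ((w - ρ₀) * (q + lam₁)) = B at hd' ⊢
    field_simp
    linear_combination -hd'
  have hc0 : Continuous (F 0) := continuous_iff_continuousAt.2 fun w => by
    obtain ⟨d, hd, -⟩ := hF0 w
    exact hd.continuousAt
  have hc1 : Continuous (F 1) := continuous_iff_continuousAt.2 fun w => (hF1 w).continuousAt
  have hFc : ∀ j, Continuous (F j) := Fin.forall_fin_two.2 ⟨hc0, hc1⟩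
  have hlam : ∀ j, 0 < ![lam₀, lam₁] j := Fin.forall_fin_two.2 ⟨hlam₀, hlam₁⟩
  have hstep : ∀ j z, z < y →
      ∫ t, passageStep ρ₀ γ₀ y q j (F (1 - j)) z t ∂expMeasure (![lam₀, lam₁] j) = F j z :=
    Fin.forall_fin_two.2 ⟨fun z hz => integral_passageStep_zero hγ₀ hlam₀ hq hy hz hc1 hF0,
      fun z hz => integral_passageStep_one ρ₀ γ₀ hlam₁ hz hc0 hF1 (div_self hDpos.ne')⟩
  refine ⟨hDpos.ne', fun hε => ?_, fun hε => ?_⟩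
  · rw [add_comm 1 β₀]
    exact hX.laplaceOfTime_firstPassageTime hε hlam hγ₀ hxy hy hq hFc hstep
  · exact hX.laplaceOfTime_firstPassageTime hε hlam hγ₀ hxy hy hq hFc hstep
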